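/- Let $d$ be a positive integer and let $G$ be a (finite simple) graph on $d+2$ vertices whose adjacency matrix $A_G$ has eigenvalues $\lambda_1\ge\lambda_2\ge\dots\ge\lambda_{d+2}$, listed with multiplicity. Let $J$ be the $(d+2)\times(d+2)$ all-ones matrix and let $P=I-\frac1{d+2}J$ be the matrix of the orthogonal projection onto the orthogonal complement of the all-ones vector. A set $S\subset\mathbb{R}^d$ is a 2-distance set if the set of distances between different points of $S$ has exactly two elements; its associated graph has the points of $S$ as vertices, two points being adjacent if and only if their distance is the larger of the two. We say that $G$ has a spherical representation in $\mathbb{R}^d$ if there is a 2-distance set $S\subset\mathbb{R}^d$, all of whose points lie on a common $(d-1)$-dimensional sphere (of positive radius) in $\mathbb{R}^d$, whose associated graph is isomorphic to $G$. Then $G$ has a spherical representation in $\mathbb{R}^d$ if and only if both of the following hold: (a) the largest eigenvalue of the $(d+2)\times(d+2)$ matrix $PA_GP$ is equal to $\lambda_2$; (b) the multiplicity of $\lambda_2$ as an eigenvalue of $A_G$, not counting $\lambda_1$ if $\lambda_1=\lambda_2$ (that is, the number of indices $i\ge 2$ with $\lambda_i=\lambda_2$), is equal to the multiplicity of $\lambda_2$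 as an eigenvalue of the $(d+2)\times(d+2)$ matrix $PA_GP$. -/

import Mathlib

noncomputable section

/-- The set of distances between two different points of `S`. -/
def distanceSet {d : ℕ} (S : Set (EuclideanSpace ℝ (Fin d))) : Set ℝ :=
  {r | ∃ p ∈ S, ∃ q ∈ S, p ≠ q ∧ r = dist p q}

/-- `S` is a 2-distance set: exactly two distances occur between different points of `S`. -/
def IsTwoDistanceSet {d : ℕ} (S : Set (EuclideanSpace ℝ (Fin d))) : Prop :=
  (distanceSet S).ncard = 2

/-- The associated graph of a 2-distance set: its vertices are the points of `S`, and two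
different points are adjacent if and only if their distance is the longer of the two distances. -/
def associatedGraph {d : ℕ} (S : Set (EuclideanSpace ℝ (Fin d))) : SimpleGraph S where
  Adj p q := p ≠ q ∧ IsGreatest (distanceSet S) (dist (p : EuclideanSpace ℝ (Fin d)) q)
  symm := ⟨fun p q h => ⟨h.1.symm, by rw [dist_comm]; exact h.2⟩⟩
  loopless := ⟨fun _ h => h.1 rfl⟩

/-- All points of `S` lie on one `(d - 1)`-dimensional sphere (of positive radius) in `ℝ^d`. -/
def IsSphericalSet {d : ℕ} (S : Set (EuclideanSpace ℝ (Fin d))) : Prop :=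
  ∃ (c : EuclideanSpace ℝ (Fin d)) (r : ℝ), 0 < r ∧ S ⊆ Metric.sphere c r

/-- `G` has a spherical representation in `ℝ^d`: it is (isomorphic to) the associated graph of a
spherical 2-distance set in `ℝ^d`. -/
def HasSphericalRepresentation {V : Type*} (G : SimpleGraph V) (d : ℕ) : Prop :=
  ∃ S : Set (EuclideanSpace ℝ (Fin d)),
    IsTwoDistanceSet S ∧ IsSphericalSet S ∧ Nonempty (G ≃g associatedGraph S)

/-- The eigenvalues of the adjacency matrix of `G`, listed with multiplicity in decreasing order;
indices start at `0`, so `λ₁` has index `0` and `λ₂` has index `1`. -/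
def adjEigenvalues {V : Type*} [Fintype V] [DecidableEq V] (G : SimpleGraph V)
    [DecidableRel G.Adj] : Fin (Fintype.card V) → ℝ :=
  Matrix.IsHermitian.eigenvalues₀ (A := G.adjMatrix ℝ)
    (by rw [Matrix.IsHermitian, Matrix.conjTranspose_eq_transpose_of_trivial]
        exact G.transpose_adjMatrix)

/-- `P = I - J / |V|`, the orthogonal projection onto the complement of the all-ones vector. -/
def centeringMatrix (V : Type*) [Fintype V] [DecidableEq V] : Matrix V V ℝ :=
  1 - (Fintype.card V : ℝ)⁻¹ • Matrix.of (fun _ _ => 1)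

/-- The `V × V` matrix `P A_G P`. -/
def projectedAdjMatrix {V : Type*} [Fintype V] [DecidableEq V] (G : SimpleGraph V)
    [DecidableRel G.Adj] : Matrix V V ℝ :=
  centeringMatrix V * G.adjMatrix ℝ * centeringMatrix V

/-- The multiplicity of `μ` as an eigenvalue of a (symmetric) real matrix: the dimension of the
eigenspace. -/
def eigenMultiplicity {V : Type*} [Fintype V] [DecidableEq V] (M : Matrix V V ℝ) (μ : ℝ) : ℕ :=
  Module.finrank ℝ (Module.End.eigenspace (Matrix.toLin' M) μ)

end

/-!
Place the centre of the sphere at the origin and rescale. The Gram matrix of a spherical two-distance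
set with graph `G` then becomes `N = θ I - A + s J` with `θ > 0`, where `A` is the adjacency matrix
and `J` the all-ones matrix. Conversely a positive semidefinite `N` of this form and of rank at most
`d` is the Gram matrix of such a set in `ℝ^d`. Since `|V| = d + 2`, a spherical representation exists
if and only if some `N` with `θ > 0` is positive semidefinite with a kernel of dimension at least two
(`exists_posSemidef_of_hasSphericalRepresentation`, `hasSphericalRepresentation_of_posSemidef`).

Given such an `N`, a nonzero kernel vector `v` orthogonal to the all-ones vector is a
`θ`-eigenvector of `A`, and testing `N` on `|v|` gives `s ≥ 0`. Thus the form of `A` is at least `θ`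
on `ker N` and at most `θ` on the complement of the all-ones vector, and Courant–Fischer gives
`θ = λ₂`. The `θ`-eigenvectors of `P A P` are the `θ`-eigenvectors of `A` orthogonal to the all-ones
vector. If `λ₁ = λ₂`, the absolute value of a top eigenvector is an eigenvector not orthogonal to
the all-ones vector, and if `λ₁ > λ₂` all of them are orthogonal to it
(`dotProduct_eq_zero_of_eigenvector`); this is the multiplicity condition
(`spectral_conditions_of_posSemidef`).

For the converse take `θ = λ₂`. It is positive: the all-ones vector is an eigenvector of `P A P` for
`0`, which would spoil the multiplicity condition at `λ₂ = 0`. If `λ₁ = λ₂`, then `s = 0` works. If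
`λ₁ > λ₂`, the all-ones vector is orthogonal to the kernel of `θ - A`, hence equals `(θ - A) w` for
some `w`, and the choice of `s` that puts `w` into `ker N` makes `N` positive semidefinite
(`exists_posSemidef_of_spectral_conditions`).
-/

open Matrix

/-! ### Kernels of functionals, quadratic forms and the spectral theorem -/

theorem Submodule.finrank_eq_inf_ker_add {M : Type*} [AddCommGroup M] [Module ℝ M]
    [FiniteDimensional ℝ M] (E : Submodule ℝ M) (φ : M →ₗ[ℝ] ℝ) [Decidable (E ≤ LinearMap.ker φ)] :
    Module.finrank ℝ E =
      Module.finrank ℝ (E ⊓ LinearMap.ker φ : Submodule ℝ M) +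
        if E ≤ LinearMap.ker φ then 0 else 1 := by
  split_ifs with h
  · rw [inf_eq_left.mpr h, add_zero]
  · have hne : φ.domRestrict E ≠ 0 := by
      intro h0
      exact h fun x hx => by simpa using LinearMap.congr_fun h0 ⟨x, hx⟩
    have h1 := (φ.domRestrict E).finrank_range_add_finrank_ker
    rw [LinearMap.range_eq_top.mpr (LinearMap.surjective hne), finrank_top,
      Module.finrank_self] at h1
    have h2 : Module.finrank ℝ (LinearMap.ker (φ.domRestrict E)) =
        Module.finrank ℝ (E ⊓ LinearMap.ker φ : Submodule ℝ M) := by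
      rw [← Submodule.finrank_map_subtype_eq E (LinearMap.ker (φ.domRestrict E))]
      have h3 : (LinearMap.ker (φ.domRestrict E)).map E.subtype = E ⊓ LinearMap.ker φ := by
        ext x
        simp [and_comm]
      rw [h3]
    omega

theorem Submodule.exists_ne_zero_mem_ker {M : Type*} [AddCommGroup M] [Module ℝ M]
    [FiniteDimensional ℝ M] {E : Submodule ℝ M} (hE : 2 ≤ Module.finrank ℝ E) (φ : M →ₗ[ℝ] ℝ) :
    ∃ x ∈ E, x ≠ 0 ∧ φ x = 0 := by
  classical
  have h := E.finrank_eq_inf_ker_add φ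
  have hpos : 0 < Module.finrank ℝ (E ⊓ LinearMap.ker φ : Submodule ℝ M) := by
    split_ifs at h <;> omega
  obtain ⟨x, hx⟩ := Module.finrank_pos_iff_exists_ne_zero.mp hpos
  exact ⟨x, x.2.1, by simpa using hx, x.2.2⟩

theorem Submodule.two_le_finrank_of_pair {M : Type*} [AddCommGroup M] [Module ℝ M]
    [FiniteDimensional ℝ M] {E : Submodule ℝ M} (φ : M →ₗ[ℝ] ℝ) {x y : M} (hx : x ∈ E) (hy : y ∈ E)
    (hx0 : x ≠ 0) (hφx : φ x = 0) (hφy : φ y ≠ 0) : 2 ≤ Module.finrank ℝ E := by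
  classical
  have h := E.finrank_eq_inf_ker_add φ
  have hpos : 0 < Module.finrank ℝ (E ⊓ LinearMap.ker φ : Submodule ℝ M) :=
    Module.finrank_pos_iff_exists_ne_zero.mpr ⟨⟨x, hx, hφx⟩, fun h0 => hx0 (congrArg Subtype.val h0)⟩
  rw [if_neg (fun hle => hφy (hle hy))] at h
  omega

section QuadraticForms

variable {V : Type*} [Fintype V]

theorem Matrix.IsHermitian.dotProduct_mulVec_swap {A : Matrix V V ℝ} (hA : A.IsHermitian)
    (x y : V → ℝ) : x ⬝ᵥ A *ᵥ y = y ⬝ᵥ A *ᵥ x := by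
  rw [dotProduct_mulVec, ← mulVec_transpose, dotProduct_comm,
    ← conjTranspose_eq_transpose_of_trivial, hA.eq]

theorem dotProduct_abs_self (x : V → ℝ) : |x| ⬝ᵥ |x| = x ⬝ᵥ x :=
  Finset.sum_congr rfl fun i _ => abs_mul_abs_self (x i)

theorem one_dotProduct_abs_pos {x : V → ℝ} (hx : x ≠ 0) : 0 < 1 ⬝ᵥ |x| := by
  obtain ⟨i, hi⟩ := Function.ne_iff.mp hx
  have : 0 < ∑ i, |x i| :=
    Finset.sum_pos' (fun i _ => abs_nonneg _) ⟨i, Finset.mem_univ i, abs_pos.mpr hi⟩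
  simpa [dotProduct] using this

/-- Passing to absolute values can only increase the quadratic form of a matrix with nonnegative
entries; this is the part of Perron–Frobenius theory that the argument needs. -/
theorem dotProduct_mulVec_le_abs {A : Matrix V V ℝ} (h0 : ∀ i j, 0 ≤ A i j) (x : V → ℝ) :
    x ⬝ᵥ A *ᵥ x ≤ |x| ⬝ᵥ A *ᵥ |x| := by
  simp only [dotProduct, mulVec, Finset.mul_sum]
  refine Finset.sum_le_sum fun i _ => Finset.sum_le_sum fun j _ => ?_
  calc x i * (A i j * x j) ≤ |x i * (A i j * x j)| := le_abs_self _
    _ = |x| i * (A i j * |x| j) := by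
      simp [abs_mul, abs_of_nonneg (h0 i j)]

theorem dotProduct_self_pos {x : V → ℝ} (hx : x ≠ 0) : 0 < x ⬝ᵥ x := by
  obtain ⟨i, hi⟩ := Function.ne_iff.mp hx
  exact Finset.sum_pos' (fun i _ => mul_self_nonneg _)
    ⟨i, Finset.mem_univ i, mul_self_pos.mpr hi⟩

theorem allOnes_mulVec (x : V → ℝ) :
    (Matrix.of fun _ _ => (1 : ℝ)) *ᵥ x = (1 ⬝ᵥ x) • (1 : V → ℝ) := by
  ext i
  simp [mulVec, dotProduct]

theorem posSemidef_real_iff {N : Matrix V V ℝ} (hN : N.IsHermitian) :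
    N.PosSemidef ↔ ∀ x : V → ℝ, 0 ≤ x ⬝ᵥ N *ᵥ x :=
  ⟨fun h x => by simpa using h.dotProduct_mulVec_nonneg x,
    fun h => .of_dotProduct_mulVec_nonneg hN fun x => by simpa using h x⟩

/-- The matrix `θ I - A + s J`, with `J` the all-ones matrix. Up to a positive factor, the Gram
matrices of the spherical two-distance sets with graph `A`, the centre of the sphere being the
origin, have this form. -/
def shiftedMatrix {V : Type*} [DecidableEq V] (A : Matrix V V ℝ) (θ s : ℝ) : Matrix V V ℝ :=
  θ • 1 - A + s • Matrix.of fun _ _ => 1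

theorem isHermitian_shiftedMatrix {V : Type*} [DecidableEq V] {A : Matrix V V ℝ}
    (hA : A.IsHermitian) (θ s : ℝ) : (shiftedMatrix A θ s).IsHermitian := by
  ext i j
  have := congrFun (congrFun hA.eq i) j
  simp only [conjTranspose_apply, star_trivial] at this
  simp [shiftedMatrix, this, one_apply, eq_comm]

variable [DecidableEq V]

theorem shiftedMatrix_mulVec (A : Matrix V V ℝ) (θ s : ℝ) (x : V → ℝ) :
    shiftedMatrix A θ s *ᵥ x = θ • x - A *ᵥ x + (s * (1 ⬝ᵥ x)) • (1 : V → ℝ) := by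
  rw [shiftedMatrix, add_mulVec, sub_mulVec, smul_mulVec, smul_mulVec, one_mulVec,
    allOnes_mulVec, smul_smul]

theorem dotProduct_shiftedMatrix_mulVec (A : Matrix V V ℝ) (θ s : ℝ) (x y : V → ℝ) :
    y ⬝ᵥ shiftedMatrix A θ s *ᵥ x =
      θ * (y ⬝ᵥ x) - y ⬝ᵥ A *ᵥ x + s * (1 ⬝ᵥ x) * (1 ⬝ᵥ y) := by
  rw [shiftedMatrix_mulVec, dotProduct_add, dotProduct_sub, dotProduct_smul, dotProduct_smul,
    dotProduct_comm y 1]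
  simp only [smul_eq_mul]

/-- The two largest eigenvalues with orthonormal eigenvectors; the top eigenvector can be split off,
and `λ₂` bounds the quadratic form on its orthogonal complement. -/
theorem exists_top_two_eigenvectors {A : Matrix V V ℝ} (hA : A.IsHermitian)
    (h0 : 0 < Fintype.card V) (h1 : 1 < Fintype.card V) :
    ∃ e f : V → ℝ, e ⬝ᵥ e = 1 ∧ f ⬝ᵥ f = 1 ∧ e ⬝ᵥ f = 0 ∧
      A *ᵥ e = hA.eigenvalues₀ ⟨0, h0⟩ • e ∧ A *ᵥ f = hA.eigenvalues₀ ⟨1, h1⟩ • f ∧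
      hA.eigenvalues₀ ⟨1, h1⟩ ≤ hA.eigenvalues₀ ⟨0, h0⟩ ∧
      ∀ x : V → ℝ, e ⬝ᵥ x = 0 → x ⬝ᵥ A *ᵥ x ≤ hA.eigenvalues₀ ⟨1, h1⟩ * (x ⬝ᵥ x) := by
  set σ : Fin (Fintype.card V) ≃ V := Fintype.equivOfCardEq (Fintype.card_fin _) with hσ
  set b := hA.eigenvectorBasis with hb
  have hdot : ∀ i j, (b i : V → ℝ) ⬝ᵥ (b j : V → ℝ) = if i = j then 1 else 0 := by
    intro i j
    have := orthonormal_iff_ite.mp b.orthonormal i j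
    rw [EuclideanSpace.inner_eq_star_dotProduct, dotProduct_comm] at this
    simpa using this
  have hAb : ∀ k, A *ᵥ (b (σ k) : V → ℝ) = hA.eigenvalues₀ k • (b (σ k) : V → ℝ) := by
    intro k
    have := hA.mulVec_eigenvectorBasis (σ k)
    rwa [IsHermitian.eigenvalues, ← hσ, Equiv.symm_apply_apply] at this
  refine ⟨b (σ ⟨0, h0⟩), b (σ ⟨1, h1⟩), by simp [hdot], by simp [hdot], by simp [hdot], hAb _,
    hAb _, hA.eigenvalues₀_antitone (by simp [Fin.le_def]), fun x hx => ?_⟩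
  have hexp : x = ∑ k, ((b (σ k) : V → ℝ) ⬝ᵥ x) • (b (σ k) : V → ℝ) := by
    have := congrArg WithLp.ofLp (b.sum_repr' (WithLp.toLp 2 x))
    rw [Equiv.sum_comp σ (fun i => ((b i : V → ℝ) ⬝ᵥ x) • (b i : V → ℝ))]
    refine this.symm.trans ?_
    rw [WithLp.ofLp_sum]
    refine Finset.sum_congr rfl fun i _ => ?_
    rw [EuclideanSpace.inner_eq_star_dotProduct, dotProduct_comm]
    simp
  have hxy : ∀ y : V → ℝ, x ⬝ᵥ y =
      ∑ k, ((b (σ k) : V → ℝ) ⬝ᵥ x) * ((b (σ k) : V → ℝ) ⬝ᵥ y) := by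
    intro y
    conv_lhs => rw [hexp, sum_dotProduct]
    simp [smul_dotProduct]
  rw [hxy, hxy x, Finset.mul_sum]
  refine Finset.sum_le_sum fun k _ => ?_
  rw [hA.dotProduct_mulVec_swap, hAb, dotProduct_smul, smul_eq_mul, dotProduct_comm x]
  rcases Nat.eq_zero_or_pos k.1 with hk | hk
  · have : k = ⟨0, h0⟩ := Fin.ext hk
    rw [this, hx]
    simp
  · have hle : hA.eigenvalues₀ k ≤ hA.eigenvalues₀ ⟨1, h1⟩ :=
      hA.eigenvalues₀_antitone (Fin.le_def.mpr hk)
    nlinarith [mul_le_mul_of_nonneg_right hle (mul_self_nonneg ((b (σ k) : V → ℝ) ⬝ᵥ x))]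

end QuadraticForms

/-! ### Variational estimates for the two largest eigenvalues -/

theorem mem_eigenspace_toLin'_iff {V : Type*} [Fintype V] [DecidableEq V] {M : Matrix V V ℝ}
    {μ : ℝ} {x : V → ℝ} :
    x ∈ Module.End.eigenspace (Matrix.toLin' M) μ ↔ M *ᵥ x = μ • x := by
  rw [Module.End.mem_eigenspace_iff, toLin'_apply]

section TopTwo

variable {V : Type*} [Fintype V] {A : Matrix V V ℝ} {l₁ l₂ θ : ℝ} {e f : V → ℝ}

theorem dotProduct_mulVec_le_of_top (hA : A.IsHermitian) (hee : e ⬝ᵥ e = 1)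
    (hAe : A *ᵥ e = l₁ • e) (hle : l₂ ≤ l₁)
    (hmax : ∀ x : V → ℝ, e ⬝ᵥ x = 0 → x ⬝ᵥ A *ᵥ x ≤ l₂ * (x ⬝ᵥ x)) (x : V → ℝ) :
    x ⬝ᵥ A *ᵥ x ≤ l₁ * (x ⬝ᵥ x) := by
  set a := e ⬝ᵥ x with ha
  set y := x - a • e with hy
  have hey : e ⬝ᵥ y = 0 := by simp [hy, dotProduct_sub, hee, ← ha]
  have hye : y ⬝ᵥ e = 0 := by rw [dotProduct_comm, hey]
  have hx : x = y + a • e := by simp [hy]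
  have heAy : e ⬝ᵥ A *ᵥ y = 0 := by
    rw [hA.dotProduct_mulVec_swap, hAe, dotProduct_smul, hye, smul_zero]
  have h1 : x ⬝ᵥ A *ᵥ x = y ⬝ᵥ A *ᵥ y + a ^ 2 * l₁ := by
    rw [hx]
    simp only [mulVec_add, mulVec_smul, add_dotProduct, dotProduct_add, smul_dotProduct,
      dotProduct_smul, hAe, heAy, hye, hee, smul_eq_mul]
    ring
  have h2 : x ⬝ᵥ x = y ⬝ᵥ y + a ^ 2 := by
    rw [hx]
    simp only [add_dotProduct, dotProduct_add, smul_dotProduct,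
      dotProduct_smul, hey, hye, hee, smul_eq_mul]
    ring
  have h3 := hmax y hey
  have h4 : 0 ≤ y ⬝ᵥ y := dotProduct_self_star_nonneg y
  rw [h1, h2]
  nlinarith [mul_le_mul_of_nonneg_right hle h4]

/-- Courant–Fischer: a bound for the quadratic form on a hyperplane bounds `λ₂`. -/
theorem second_eigenvalue_le (hee : e ⬝ᵥ e = 1) (hff : f ⬝ᵥ f = 1) (hef : e ⬝ᵥ f = 0)
    (hAe : A *ᵥ e = l₁ • e) (hAf : A *ᵥ f = l₂ • f) (hle : l₂ ≤ l₁) {u : V → ℝ}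
    (hθ : ∀ x : V → ℝ, u ⬝ᵥ x = 0 → x ⬝ᵥ A *ᵥ x ≤ θ * (x ⬝ᵥ x)) : l₂ ≤ θ := by
  by_cases hf0 : u ⬝ᵥ f = 0
  · have := hθ f hf0
    simpa [hAf, hff] using this
  · have hfe : f ⬝ᵥ e = 0 := by rw [dotProduct_comm, hef]
    set p := u ⬝ᵥ f with hp
    set q := u ⬝ᵥ e with hq
    have h := hθ (p • e - q • f) (by
      rw [dotProduct_sub, dotProduct_smul, dotProduct_smul, ← hp, ← hq]
      simp only [smul_eq_mul]
      ring)
    simp only [mulVec_sub, mulVec_smul, sub_dotProduct, dotProduct_sub, smul_dotProduct,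
      dotProduct_smul, hAe, hAf, hef, hfe, hee, hff, smul_eq_mul] at h
    have hp2 : 0 < p ^ 2 := by positivity
    by_contra! hlt
    nlinarith [mul_nonneg (sq_nonneg p) (sub_nonneg.mpr hle), sq_nonneg q,
      mul_pos hp2 (sub_pos.mpr hlt), mul_nonneg (sq_nonneg q) (sub_pos.mpr hlt).le]

/-- Courant–Fischer: a lower bound for the quadratic form on a plane bounds `λ₂` from below. -/
theorem le_second_eigenvalue
    (hmax : ∀ x : V → ℝ, e ⬝ᵥ x = 0 → x ⬝ᵥ A *ᵥ x ≤ l₂ * (x ⬝ᵥ x)) {K : Submodule ℝ (V → ℝ)}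
    (hK : 2 ≤ Module.finrank ℝ K) (hθ : ∀ x ∈ K, θ * (x ⬝ᵥ x) ≤ x ⬝ᵥ A *ᵥ x) : θ ≤ l₂ := by
  obtain ⟨x, hxK, hx0, hex⟩ := K.exists_ne_zero_mem_ker hK (dotProductBilin ℝ ℝ e)
  exact le_of_mul_le_mul_right ((hθ x hxK).trans (hmax x hex)) (dotProduct_self_pos hx0)

/-- If the quadratic form of `A` is at most `θ` on the hyperplane `u^⊥` while `A` has an eigenvalue
above `θ`, then the `θ`-eigenvectors are orthogonal to `u`: otherwise subtracting a multiple of such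
an eigenvector moves the top eigenvector into `u^⊥` without lowering the form of `A - θ`. -/
theorem dotProduct_eq_zero_of_eigenvector (hA : A.IsHermitian) (hee : e ⬝ᵥ e = 1)
    (hAe : A *ᵥ e = l₁ • e) (hlt : θ < l₁) {u : V → ℝ}
    (hθ : ∀ x : V → ℝ, u ⬝ᵥ x = 0 → x ⬝ᵥ A *ᵥ x ≤ θ * (x ⬝ᵥ x)) {v : V → ℝ}
    (hv : A *ᵥ v = θ • v) : u ⬝ᵥ v = 0 := by
  by_contra hne
  have hev : e ⬝ᵥ v = 0 := by
    have h := hA.dotProduct_mulVec_swap e v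
    rw [hv, hAe, dotProduct_smul, dotProduct_smul, dotProduct_comm v e, smul_eq_mul,
      smul_eq_mul] at h
    have : (l₁ - θ) * (e ⬝ᵥ v) = 0 := by linarith
    exact (mul_eq_zero.mp this).resolve_left (sub_pos.mpr hlt).ne'
  have hve : v ⬝ᵥ e = 0 := by rw [dotProduct_comm, hev]
  set p := u ⬝ᵥ v with hp
  set q := u ⬝ᵥ e with hq
  have h := hθ (p • e - q • v) (by
    rw [dotProduct_sub, dotProduct_smul, dotProduct_smul, ← hp, ← hq]
    simp only [smul_eq_mul]
    ring)
  simp only [mulVec_sub, mulVec_smul, sub_dotProduct, dotProduct_sub, smul_dotProduct,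
    dotProduct_smul, hAe, hv, hev, hve, hee, smul_eq_mul] at h
  have hp2 : 0 < p ^ 2 := by positivity
  nlinarith [mul_pos hp2 (sub_pos.mpr hlt)]

end TopTwo

theorem shiftedMatrix_mulVec_eq_zero_of_form {V : Type*} [Fintype V] [DecidableEq V]
    {A : Matrix V V ℝ} {θ s : ℝ} (hN : (shiftedMatrix A θ s).PosSemidef) {x : V → ℝ}
    (hx : x ⬝ᵥ shiftedMatrix A θ s *ᵥ x = 0) : shiftedMatrix A θ s *ᵥ x = 0 :=
  (hN.dotProduct_mulVec_zero_iff x).mp (by simpa using hx)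

/-! ### The projected adjacency matrix -/

section Projection

variable {V : Type*} [Fintype V] [DecidableEq V]

theorem centeringMatrix_mulVec (x : V → ℝ) :
    centeringMatrix V *ᵥ x = x - ((Fintype.card V : ℝ)⁻¹ * (1 ⬝ᵥ x)) • (1 : V → ℝ) := by
  rw [centeringMatrix, sub_mulVec, smul_mulVec, one_mulVec, allOnes_mulVec, smul_smul]

theorem centeringMatrix_mulVec_of_orthogonal {x : V → ℝ} (hx : 1 ⬝ᵥ x = 0) :
    centeringMatrix V *ᵥ x = x := by
  rw [centeringMatrix_mulVec, hx, mul_zero, zero_smul, sub_zero]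

theorem isHermitian_centeringMatrix : (centeringMatrix V).IsHermitian := by
  ext i j
  simp [centeringMatrix, one_apply, eq_comm]

theorem one_dotProduct_one_ne_zero {V : Type*} [Fintype V] [Nonempty V] :
    (1 : V → ℝ) ⬝ᵥ 1 ≠ 0 := by
  simp [dotProduct]

theorem one_dotProduct_centeringMatrix_mulVec [Nonempty V] (x : V → ℝ) :
    1 ⬝ᵥ centeringMatrix V *ᵥ x = 0 := by
  have : (Fintype.card V : ℝ) ≠ 0 := by simp
  rw [centeringMatrix_mulVec, dotProduct_sub, dotProduct_smul]
  simp only [dotProduct_one, Pi.one_apply, Finset.sum_const, Finset.card_univ, nsmul_eq_mul,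
    mul_one, smul_eq_mul]
  field_simp
  ring

theorem centeringMatrix_mulVec_one [Nonempty V] : centeringMatrix V *ᵥ (1 : V → ℝ) = 0 := by
  have : (Fintype.card V : ℝ) ≠ 0 := by simp
  rw [centeringMatrix_mulVec]
  simp [dotProduct, this]

variable (G : SimpleGraph V) [DecidableRel G.Adj]

theorem isHermitian_adjMatrix {V : Type*} (G : SimpleGraph V) [DecidableRel G.Adj] :
    (G.adjMatrix ℝ).IsHermitian := by
  rw [IsHermitian, conjTranspose_eq_transpose_of_trivial, G.transpose_adjMatrix]

theorem adjMatrix_nonneg {V : Type*} (G : SimpleGraph V) [DecidableRel G.Adj]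
    (i j : V) : 0 ≤ G.adjMatrix ℝ i j := by
  rw [SimpleGraph.adjMatrix_apply]
  split_ifs <;> norm_num

theorem projectedAdjMatrix_mulVec (x : V → ℝ) :
    projectedAdjMatrix G *ᵥ x =
      centeringMatrix V *ᵥ G.adjMatrix ℝ *ᵥ centeringMatrix V *ᵥ x := by
  rw [projectedAdjMatrix, ← mulVec_mulVec, ← mulVec_mulVec]

theorem isHermitian_projectedAdjMatrix : (projectedAdjMatrix G).IsHermitian := by
  have h := isHermitian_conjTranspose_mul_mul (centeringMatrix V) (isHermitian_adjMatrix G)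
  rwa [isHermitian_centeringMatrix.eq] at h

theorem projectedAdjMatrix_form {x : V → ℝ} (hx : 1 ⬝ᵥ x = 0) :
    x ⬝ᵥ projectedAdjMatrix G *ᵥ x = x ⬝ᵥ G.adjMatrix ℝ *ᵥ x := by
  rw [projectedAdjMatrix_mulVec, isHermitian_centeringMatrix.dotProduct_mulVec_swap,
    centeringMatrix_mulVec_of_orthogonal hx, dotProduct_comm]

theorem one_dotProduct_eq_zero_of_projectedAdjMatrix_eigenvector [Nonempty V] {μ : ℝ} (hμ : μ ≠ 0)
    {x : V → ℝ} (hx : projectedAdjMatrix G *ᵥ x = μ • x) : 1 ⬝ᵥ x = 0 := by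
  have h := congrArg (1 ⬝ᵥ ·) hx
  simp only [projectedAdjMatrix_mulVec, one_dotProduct_centeringMatrix_mulVec, dotProduct_smul,
    smul_eq_mul] at h
  exact (mul_eq_zero.mp h.symm).resolve_left hμ

theorem projectedAdjMatrix_mulVec_of_eigenvector {μ : ℝ} {x : V → ℝ} (h1 : 1 ⬝ᵥ x = 0)
    (hx : G.adjMatrix ℝ *ᵥ x = μ • x) : projectedAdjMatrix G *ᵥ x = μ • x := by
  rw [projectedAdjMatrix_mulVec, centeringMatrix_mulVec_of_orthogonal h1, hx, mulVec_smul,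
    centeringMatrix_mulVec_of_orthogonal h1]

/-- An upper bound for the eigenvalues of a symmetric matrix bounds its quadratic form. -/
theorem posSemidef_shiftedMatrix_of_eigenvalues_le {M : Matrix V V ℝ} (hM : M.IsHermitian) {θ : ℝ}
    (hθ : ∀ μ, Module.End.HasEigenvalue (Matrix.toLin' M) μ → μ ≤ θ) :
    (shiftedMatrix M θ 0).PosSemidef := by
  have hH := isHermitian_shiftedMatrix hM θ 0
  rw [hH.posSemidef_iff_eigenvalues_nonneg]
  intro i
  have h := hH.mulVec_eigenvectorBasis i
  set v : V → ℝ := (hH.eigenvectorBasis i).ofLp with hv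
  have hv0 : v ≠ 0 := by
    intro h0
    exact hH.eigenvectorBasis.orthonormal.ne_zero i (by ext j; exact congrFun h0 j)
  rw [shiftedMatrix_mulVec, zero_mul, zero_smul, add_zero] at h
  have h' : M *ᵥ v = (θ - hH.eigenvalues i) • v := by
    rw [sub_smul, ← h]
    abel
  have := hθ _ (Module.End.hasEigenvalue_of_hasEigenvector
    ⟨mem_eigenspace_toLin'_iff.mpr h', hv0⟩)
  simp only [Pi.zero_apply]
  linarith

end Projection

/-! ### The spectral criterion -/

section SpectralCriterion

variable {V : Type*} [Fintype V] [DecidableEq V] (G : SimpleGraph V) [DecidableRel G.Adj]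
  {θ s l₁ l₂ : ℝ} {e f : V → ℝ}

theorem adjMatrix_form_le_of_posSemidef (hN : (shiftedMatrix (G.adjMatrix ℝ) θ s).PosSemidef)
    (x : V → ℝ) (hx : 1 ⬝ᵥ x = 0) : x ⬝ᵥ G.adjMatrix ℝ *ᵥ x ≤ θ * (x ⬝ᵥ x) := by
  have h := (posSemidef_real_iff hN.1).mp hN x
  rw [dotProduct_shiftedMatrix_mulVec, hx] at h
  linarith

theorem adjMatrix_mulVec_of_mem_ker {x : V → ℝ}
    (hx : shiftedMatrix (G.adjMatrix ℝ) θ s *ᵥ x = 0) (h1 : 1 ⬝ᵥ x = 0) :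
    G.adjMatrix ℝ *ᵥ x = θ • x := by
  rw [shiftedMatrix_mulVec, h1, mul_zero, zero_smul, add_zero] at hx
  exact (sub_eq_zero.mp hx).symm

/-- A positive semidefinite `θ I - A + s J` whose kernel contains a nonzero vector `v` orthogonal to
the all-ones vector has `s ≥ 0`, as one sees by testing it on `|v|`. -/
theorem shift_nonneg (hN : (shiftedMatrix (G.adjMatrix ℝ) θ s).PosSemidef) {v : V → ℝ}
    (hv : shiftedMatrix (G.adjMatrix ℝ) θ s *ᵥ v = 0) (hv0 : v ≠ 0) (h1 : 1 ⬝ᵥ v = 0) : 0 ≤ s := by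
  have h := (posSemidef_real_iff hN.1).mp hN |v|
  have hAv := dotProduct_mulVec_le_abs (adjMatrix_nonneg G) v
  rw [adjMatrix_mulVec_of_mem_ker G hv h1, dotProduct_smul, smul_eq_mul] at hAv
  rw [dotProduct_shiftedMatrix_mulVec, dotProduct_abs_self] at h
  have hpos := one_dotProduct_abs_pos hv0
  by_contra! hs
  nlinarith [mul_pos_of_neg_of_neg hs (neg_neg_of_pos (mul_pos hpos hpos))]

/-- When `θ I - A + s J` is positive semidefinite, the `θ`-eigenspace
of `P A P` for `θ ≠ 0` consists of the `θ`-eigenvectors of `A` orthogonal to the all-ones vector. -/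
theorem projected_eigenspace_eq [Nonempty V] (hθ : θ ≠ 0)
    (hN : (shiftedMatrix (G.adjMatrix ℝ) θ s).PosSemidef) :
    Module.End.eigenspace (Matrix.toLin' (projectedAdjMatrix G)) θ =
      Module.End.eigenspace (Matrix.toLin' (G.adjMatrix ℝ)) θ ⊓
        LinearMap.ker (dotProductBilin ℝ ℝ (1 : V → ℝ)) := by
  ext x
  rw [Submodule.mem_inf, mem_eigenspace_toLin'_iff, mem_eigenspace_toLin'_iff, LinearMap.mem_ker,
    dotProductBilin_apply_apply]
  refine ⟨fun hx => ?_, fun hx => projectedAdjMatrix_mulVec_of_eigenvector G hx.2 hx.1⟩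
  have h1 := one_dotProduct_eq_zero_of_projectedAdjMatrix_eigenvector G hθ hx
  refine ⟨adjMatrix_mulVec_of_mem_ker G (shiftedMatrix_mulVec_eq_zero_of_form hN ?_) h1, h1⟩
  rw [dotProduct_shiftedMatrix_mulVec, ← projectedAdjMatrix_form G h1, hx, h1, dotProduct_smul,
    smul_eq_mul]
  ring

theorem eigenMultiplicity_adjMatrix_eq_add {μ : ℝ}
    [Decidable (Module.End.eigenspace (Matrix.toLin' (G.adjMatrix ℝ)) μ ≤
        LinearMap.ker (dotProductBilin ℝ ℝ (1 : V → ℝ)))] :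
    eigenMultiplicity (G.adjMatrix ℝ) μ =
      Module.finrank ℝ (Module.End.eigenspace (Matrix.toLin' (G.adjMatrix ℝ)) μ ⊓
        LinearMap.ker (dotProductBilin ℝ ℝ (1 : V → ℝ)) : Submodule ℝ (V → ℝ)) +
      if Module.End.eigenspace (Matrix.toLin' (G.adjMatrix ℝ)) μ ≤
        LinearMap.ker (dotProductBilin ℝ ℝ (1 : V → ℝ)) then 0 else 1 :=
  Submodule.finrank_eq_inf_ker_add _ _

/-- The shift is nonnegative, so the form of `A` is at least `θ` on the kernel of the shifted matrix
and at most `θ` on the complement of the all-ones vector; hence `θ = λ₂`. The multiplicities then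
differ by one exactly when some `θ`-eigenvector of `A` is not orthogonal to the all-ones vector. -/
theorem spectral_conditions_of_posSemidef [Nonempty V]
    (hee : e ⬝ᵥ e = 1) (hff : f ⬝ᵥ f = 1) (hef : e ⬝ᵥ f = 0)
    (hAe : G.adjMatrix ℝ *ᵥ e = l₁ • e) (hAf : G.adjMatrix ℝ *ᵥ f = l₂ • f) (hle : l₂ ≤ l₁)
    (hmax : ∀ x : V → ℝ, e ⬝ᵥ x = 0 → x ⬝ᵥ G.adjMatrix ℝ *ᵥ x ≤ l₂ * (x ⬝ᵥ x))
    (hθ : 0 < θ) (hN : (shiftedMatrix (G.adjMatrix ℝ) θ s).PosSemidef)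
    (hker : 2 ≤ Module.finrank ℝ
      (LinearMap.ker (Matrix.toLin' (shiftedMatrix (G.adjMatrix ℝ) θ s)))) :
    IsGreatest {μ : ℝ | Module.End.HasEigenvalue (Matrix.toLin' (projectedAdjMatrix G)) μ} l₂ ∧
      eigenMultiplicity (G.adjMatrix ℝ) l₂ =
        eigenMultiplicity (projectedAdjMatrix G) l₂ + (if l₁ = l₂ then 1 else 0) := by
  classical
  have hA := isHermitian_adjMatrix G
  have hform := adjMatrix_form_le_of_posSemidef G hN
  obtain ⟨v, hvN, hv0, hv1⟩ :=
    Submodule.exists_ne_zero_mem_ker hker (dotProductBilin ℝ ℝ (1 : V → ℝ))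
  rw [dotProductBilin_apply_apply] at hv1
  rw [LinearMap.mem_ker, toLin'_apply] at hvN
  have hs := shift_nonneg G hN hvN hv0 hv1
  have hle₂ : θ ≤ l₂ := by
    refine le_second_eigenvalue hmax hker fun x hx => ?_
    rw [LinearMap.mem_ker, toLin'_apply] at hx
    have h := dotProduct_shiftedMatrix_mulVec (G.adjMatrix ℝ) θ s x x
    rw [hx, dotProduct_zero] at h
    nlinarith [mul_nonneg hs (mul_self_nonneg (1 ⬝ᵥ x))]
  obtain rfl : θ = l₂ := le_antisymm hle₂ (second_eigenvalue_le hee hff hef hAe hAf hle hform)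
  refine ⟨⟨?_, fun μ hμ => ?_⟩, ?_⟩
  · exact Module.End.hasEigenvalue_of_hasEigenvector ⟨mem_eigenspace_toLin'_iff.mpr
      (projectedAdjMatrix_mulVec_of_eigenvector G hv1
        (adjMatrix_mulVec_of_mem_ker G hvN hv1)), hv0⟩
  · obtain ⟨x, hx, hx0⟩ := Module.End.HasEigenvalue.exists_hasEigenvector hμ
    rw [mem_eigenspace_toLin'_iff] at hx
    rcases le_or_gt μ 0 with h | h
    · linarith
    · have h1 := one_dotProduct_eq_zero_of_projectedAdjMatrix_eigenvector G h.ne' hx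
      have h2 := hform x h1
      rw [← projectedAdjMatrix_form G h1, hx, dotProduct_smul, smul_eq_mul] at h2
      exact le_of_mul_le_mul_right h2 (dotProduct_self_pos hx0)
  · rw [eigenMultiplicity_adjMatrix_eq_add, ← projected_eigenspace_eq G hθ.ne' hN,
      eigenMultiplicity]
    congr 1
    by_cases h12 : l₁ = θ
    · subst h12
      rw [if_pos rfl, if_neg]
      intro hsub
      -- A top eigenvector can be replaced by its absolute value, whose entries have positive sum.
      have htop := dotProduct_mulVec_le_of_top hA hee hAe hle hmax
      have hpsd : (shiftedMatrix (G.adjMatrix ℝ) l₁ 0).PosSemidef := by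
        refine (posSemidef_real_iff (isHermitian_shiftedMatrix hA _ _)).mpr fun x => ?_
        rw [dotProduct_shiftedMatrix_mulVec]
        linarith [htop x]
      have he0 : e ≠ 0 := by
        rintro rfl
        simp at hee
      have habs := dotProduct_mulVec_le_abs (adjMatrix_nonneg G) e
      have hker0 := shiftedMatrix_mulVec_eq_zero_of_form hpsd (x := |e|) (by
        have h := htop |e|
        rw [hAe, dotProduct_smul, smul_eq_mul] at habs
        rw [dotProduct_abs_self] at h
        rw [dotProduct_shiftedMatrix_mulVec, dotProduct_abs_self]
        linarith)
      rw [shiftedMatrix_mulVec, zero_mul, zero_smul, add_zero] at hker0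
      have := hsub (mem_eigenspace_toLin'_iff.mpr (sub_eq_zero.mp hker0).symm)
      exact (one_dotProduct_abs_pos he0).ne' this
    · rw [if_neg h12, if_pos]
      intro x hx
      exact dotProduct_eq_zero_of_eigenvector hA hee hAe (lt_of_le_of_ne hle (Ne.symm h12)) hform
        (mem_eigenspace_toLin'_iff.mp hx)

/-- A symmetric matrix has the vector `u` in its range as soon as `u` is orthogonal to its
kernel. -/
theorem exists_mulVec_eq_of_orthogonal_ker {B : Matrix V V ℝ} (hB : B.IsHermitian) {u : V → ℝ}
    (hu : ∀ x, B *ᵥ x = 0 → u ⬝ᵥ x = 0) : ∃ w, B *ᵥ w = u := by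
  by_contra! h
  have hmem : u ∉ LinearMap.range (Matrix.toLin' B) := by
    rintro ⟨w, hw⟩
    exact h w (by simpa using hw)
  obtain ⟨g, hgu, hg⟩ := Submodule.exists_le_ker_of_notMem hmem
  obtain ⟨z, rfl⟩ := (dotProductEquiv ℝ V).surjective g
  apply hgu
  have hz : B *ᵥ z = 0 := by
    rw [← dotProduct_self_eq_zero, hB.dotProduct_mulVec_swap]
    exact hg ⟨B *ᵥ z, by simp⟩
  rw [dotProductEquiv_apply_apply, dotProduct_comm]
  exact hu z hz

/-- If `λ₁ = λ₂`, the shift `s = 0` works. Otherwise the `λ₂`-eigenvectors of `A` and of `P A P`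
coincide, the all-ones vector is `(λ₂ - A) w` for some `w` not orthogonal to it, and `s` is chosen
so that `w` is a further kernel vector. -/
theorem exists_posSemidef_of_spectral_conditions [Nonempty V]
    (hee : e ⬝ᵥ e = 1) (hff : f ⬝ᵥ f = 1) (hef : e ⬝ᵥ f = 0)
    (hAe : G.adjMatrix ℝ *ᵥ e = l₁ • e) (hAf : G.adjMatrix ℝ *ᵥ f = l₂ • f) (hle : l₂ ≤ l₁)
    (hmax : ∀ x : V → ℝ, e ⬝ᵥ x = 0 → x ⬝ᵥ G.adjMatrix ℝ *ᵥ x ≤ l₂ * (x ⬝ᵥ x))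
    (hgreatest :
      IsGreatest {μ : ℝ | Module.End.HasEigenvalue (Matrix.toLin' (projectedAdjMatrix G)) μ} l₂)
    (hmult : eigenMultiplicity (G.adjMatrix ℝ) l₂ =
      eigenMultiplicity (projectedAdjMatrix G) l₂ + (if l₁ = l₂ then 1 else 0)) :
    0 < l₂ ∧ ∃ s, (shiftedMatrix (G.adjMatrix ℝ) l₂ s).PosSemidef ∧
      2 ≤ Module.finrank ℝ
        (LinearMap.ker (Matrix.toLin' (shiftedMatrix (G.adjMatrix ℝ) l₂ s))) := by
  classical
  have hA := isHermitian_adjMatrix G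
  have hM := posSemidef_shiftedMatrix_of_eigenvalues_le (isHermitian_projectedAdjMatrix G)
    fun μ hμ => hgreatest.2 hμ
  have hform : ∀ x : V → ℝ, 1 ⬝ᵥ x = 0 → x ⬝ᵥ G.adjMatrix ℝ *ᵥ x ≤ l₂ * (x ⬝ᵥ x) := by
    intro x hx
    have h := (posSemidef_real_iff hM.1).mp hM x
    rw [dotProduct_shiftedMatrix_mulVec, projectedAdjMatrix_form G hx] at h
    linarith
  have hone : projectedAdjMatrix G *ᵥ 1 = (0 : ℝ) • (1 : V → ℝ) := by
    rw [projectedAdjMatrix_mulVec, centeringMatrix_mulVec_one, mulVec_zero, mulVec_zero, zero_smul]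
  have hsub : l₁ ≠ l₂ → Module.End.eigenspace (Matrix.toLin' (G.adjMatrix ℝ)) l₂ ≤
      LinearMap.ker (dotProductBilin ℝ ℝ (1 : V → ℝ)) := fun h12 x hx =>
    dotProduct_eq_zero_of_eigenvector hA hee hAe (lt_of_le_of_ne hle (Ne.symm h12)) hform
      (mem_eigenspace_toLin'_iff.mp hx)
  have hinf : Module.End.eigenspace (Matrix.toLin' (G.adjMatrix ℝ)) l₂ ⊓
      LinearMap.ker (dotProductBilin ℝ ℝ (1 : V → ℝ)) ≤
        Module.End.eigenspace (Matrix.toLin' (projectedAdjMatrix G)) l₂ := fun x hx =>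
    mem_eigenspace_toLin'_iff.mpr (projectedAdjMatrix_mulVec_of_eigenvector G hx.2
      (mem_eigenspace_toLin'_iff.mp hx.1))
  have hpos : 0 < l₂ := by
    have h0 : 0 ≤ l₂ := hgreatest.2 (Module.End.hasEigenvalue_of_hasEigenvector
      ⟨mem_eigenspace_toLin'_iff.mpr hone, one_ne_zero⟩)
    refine lt_of_le_of_ne h0 fun h => ?_
    subst h
    -- The all-ones vector is an extra `0`-eigenvector of `P A P`, so the multiplicities disagree.
    have h1 : eigenMultiplicity (projectedAdjMatrix G) 0 = _ :=
      Submodule.finrank_eq_inf_ker_add _ (dotProductBilin ℝ ℝ (1 : V → ℝ))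
    rw [if_neg (fun hle' => one_dotProduct_one_ne_zero (hle' (mem_eigenspace_toLin'_iff.mpr hone)))]
      at h1
    have h2 := Submodule.finrank_mono (le_inf hinf inf_le_right)
    have h3 := eigenMultiplicity_adjMatrix_eq_add G (μ := 0)
    by_cases h12 : l₁ = 0
    · rw [if_pos h12] at hmult
      split_ifs at h3 <;> omega
    · rw [if_neg h12] at hmult
      rw [if_pos (hsub h12)] at h3
      omega
  have hf0 : f ≠ 0 := by
    rintro rfl
    simp at hff
  refine ⟨hpos, ?_⟩
  by_cases h12 : l₁ = l₂
  · subst h12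
    refine ⟨0, ?_, ?_⟩
    · refine (posSemidef_real_iff (isHermitian_shiftedMatrix hA _ _)).mpr fun x => ?_
      rw [dotProduct_shiftedMatrix_mulVec]
      linarith [dotProduct_mulVec_le_of_top hA hee hAe hle hmax x]
    · refine Submodule.two_le_finrank_of_pair (dotProductBilin ℝ ℝ e) (x := f) (y := e) ?_ ?_ hf0
        hef (by simp [hee])
      · simp [shiftedMatrix_mulVec, hAf]
      · simp [shiftedMatrix_mulVec, hAe]
  · have hsub := hsub h12
    rw [inf_eq_left.mpr hsub] at hinf
    rw [if_neg h12, add_zero] at hmult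
    have hEq := Submodule.eq_of_le_of_finrank_eq hinf hmult
    have hB := isHermitian_shiftedMatrix hA l₂ 0
    obtain ⟨w, hw⟩ := exists_mulVec_eq_of_orthogonal_ker hB (u := 1) fun x hx => by
      rw [shiftedMatrix_mulVec, zero_mul, zero_smul, add_zero] at hx
      exact hsub (mem_eigenspace_toLin'_iff.mpr (sub_eq_zero.mp hx).symm)
    have hw' : l₂ • w - G.adjMatrix ℝ *ᵥ w = 1 := by
      rwa [shiftedMatrix_mulVec, zero_mul, zero_smul, add_zero] at hw
    have hw1 : 1 ⬝ᵥ w ≠ 0 := by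
      intro h0
      have hz := shiftedMatrix_mulVec_eq_zero_of_form hM (x := w) (by
        rw [dotProduct_shiftedMatrix_mulVec, projectedAdjMatrix_form G h0]
        have := congrArg (w ⬝ᵥ ·) hw'
        simp only [dotProduct_sub, dotProduct_smul, smul_eq_mul] at this
        rw [this, dotProduct_comm, h0]
        ring)
      rw [shiftedMatrix_mulVec, zero_mul, zero_smul, add_zero] at hz
      have hwE : w ∈ Module.End.eigenspace (Matrix.toLin' (projectedAdjMatrix G)) l₂ :=
        mem_eigenspace_toLin'_iff.mpr (sub_eq_zero.mp hz).symm
      rw [← hEq, mem_eigenspace_toLin'_iff] at hwE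
      rw [hwE, sub_self] at hw'
      exact zero_ne_one hw'
    -- The shift for which `w` lies in the kernel.
    set s := -(1 ⬝ᵥ w)⁻¹ with hs
    have hNw : shiftedMatrix (G.adjMatrix ℝ) l₂ s *ᵥ w = 0 := by
      rw [shiftedMatrix_mulVec, hw', hs, neg_mul, inv_mul_cancel₀ hw1]
      simp
    have hNH := isHermitian_shiftedMatrix hA l₂ s
    have hf1 : 1 ⬝ᵥ f = 0 := hsub (mem_eigenspace_toLin'_iff.mpr hAf)
    refine ⟨s, (posSemidef_real_iff hNH).mpr fun x => ?_, ?_⟩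
    · set a := (1 ⬝ᵥ x) / (1 ⬝ᵥ w) with ha
      set y := x - a • w with hy
      have hx : x = y + a • w := by simp [hy]
      have hy1 : 1 ⬝ᵥ y = 0 := by
        rw [hy, dotProduct_sub, dotProduct_smul, smul_eq_mul, ha, div_mul_cancel₀ _ hw1, sub_self]
      have hxy : x ⬝ᵥ shiftedMatrix (G.adjMatrix ℝ) l₂ s *ᵥ x =
          y ⬝ᵥ shiftedMatrix (G.adjMatrix ℝ) l₂ s *ᵥ y := by
        have h1 : shiftedMatrix (G.adjMatrix ℝ) l₂ s *ᵥ x =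
            shiftedMatrix (G.adjMatrix ℝ) l₂ s *ᵥ y := by
          rw [hx, mulVec_add, mulVec_smul, hNw, smul_zero, add_zero]
        rw [h1, hNH.dotProduct_mulVec_swap, h1]
      rw [hxy, dotProduct_shiftedMatrix_mulVec, hy1]
      linarith [hform y hy1]
    · refine Submodule.two_le_finrank_of_pair (dotProductBilin ℝ ℝ (1 : V → ℝ)) (x := f) (y := w)
        ?_ ?_ hf0 hf1 hw1
      · simp [shiftedMatrix_mulVec, hAf, hf1]
      · simpa using hNw

end SpectralCriterion

/-! ### Gram matrices and spherical two-distance sets -/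

section Realization

variable {V : Type*} [Fintype V] [DecidableEq V]

/-- A positive semidefinite matrix of corank at least `|V| - d` is the Gram matrix of a family of
vectors in `ℝ^d`. -/
theorem exists_gram_eq_of_posSemidef {N : Matrix V V ℝ} (hN : N.PosSemidef) {d : ℕ}
    (hd : Fintype.card V ≤ d + Module.finrank ℝ (LinearMap.ker (Matrix.toLin' N))) :
    ∃ y : V → EuclideanSpace ℝ (Fin d), gram ℝ y = N := by
  have hrank : N.rank ≤ d := by
    have h : N.rank + _ = _ := (Matrix.toLin' N).finrank_range_add_finrank_ker
    rw [Module.finrank_fintype_fun_eq_card] at h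
    omega
  open scoped MatrixOrder in
  obtain ⟨B, rfl⟩ := CStarAlgebra.nonneg_iff_eq_star_mul_self.mp hN.nonneg
  rw [star_eq_conjTranspose, rank_conjTranspose_mul_self] at hrank
  let z : V → EuclideanSpace ℝ V := fun j => WithLp.toLp 2 (B.col j)
  let T := Submodule.span ℝ (Set.range z)
  have hT : Module.finrank ℝ T ≤ d := by
    refine le_trans (le_of_eq ?_) hrank
    rw [rank_eq_finrank_span_cols]
    rw [← LinearEquiv.finrank_map_eq (WithLp.linearEquiv 2 ℝ (V → ℝ)) T, Submodule.map_span,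
      ← Set.range_comp]
    rfl
  let b := stdOrthonormalBasis ℝ T
  let g : Fin (Module.finrank ℝ T) → EuclideanSpace ℝ (Fin d) :=
    fun k => EuclideanSpace.basisFun (Fin d) ℝ (Fin.castLE hT k)
  have hg : Orthonormal ℝ g :=
    (EuclideanSpace.basisFun (Fin d) ℝ).orthonormal.comp _ (Fin.castLE_injective hT)
  let ι := (b.toBasis.constr ℝ g).isometryOfOrthonormal (v := b.toBasis)
    (by simp) (by
      convert hg using 1
      ext1 k
      exact b.toBasis.constr_basis ℝ g k)
  refine ⟨fun i => ι ⟨z i, Submodule.subset_span ⟨i, rfl⟩⟩, ?_⟩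
  ext i j
  rw [gram_apply, ι.inner_map_map, Submodule.coe_inner, EuclideanSpace.inner_eq_star_dotProduct]
  simp [z, mul_apply, dotProduct, star_eq_conjTranspose, mul_comm]

variable (G : SimpleGraph V) [DecidableRel G.Adj]

/-- With the centre of the sphere at the origin, the Gram matrix of a spherical two-distance set is
a positive multiple of some `θ I - A + s J`, and it has rank at most the dimension. -/
theorem exists_posSemidef_of_hasSphericalRepresentation {d : ℕ}
    (h : HasSphericalRepresentation G d) :
    ∃ θ s : ℝ, 0 < θ ∧ (shiftedMatrix (G.adjMatrix ℝ) θ s).PosSemidef ∧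
      Fintype.card V ≤ d + Module.finrank ℝ
        (LinearMap.ker (Matrix.toLin' (shiftedMatrix (G.adjMatrix ℝ) θ s))) := by
  obtain ⟨S, hS, ⟨c, r, hr, hcr⟩, ⟨φ⟩⟩ := h
  obtain ⟨a, b, hab, hD⟩ : ∃ a b, a < b ∧ distanceSet S = {a, b} := by
    obtain ⟨a, b, hne, hD⟩ := Set.ncard_eq_two.mp hS
    rcases lt_or_gt_of_ne hne with h | h
    · exact ⟨a, b, h, hD⟩
    · exact ⟨b, a, h, by rw [hD, Set.pair_comm]⟩
  have hgr : IsGreatest (distanceSet S) b := by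
    rw [hD]
    exact ⟨by simp, by rintro x (rfl | rfl); exacts [hab.le, le_rfl]⟩
  have ha : 0 < a := by
    obtain ⟨p, -, q, -, hpq, hdist⟩ : a ∈ distanceSet S := by simp [hD]
    rw [hdist]
    exact dist_pos.mpr hpq
  let y : V → EuclideanSpace ℝ (Fin d) := fun i => (φ i : EuclideanSpace ℝ (Fin d)) - c
  have hnorm : ∀ i, ‖y i‖ = r := fun i => by
    have := hcr (φ i).2
    rwa [mem_sphere_iff_norm] at this
  have hdist : ∀ i j, i ≠ j → ‖y i - y j‖ = if G.Adj i j then b else a := by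
    intro i j hij
    have hne : φ i ≠ φ j := φ.injective.ne hij
    have hyd : ‖y i - y j‖ = dist (φ i : EuclideanSpace ℝ (Fin d)) (φ j) := by
      rw [dist_eq_norm]
      simp [y]
    have hmem : dist (φ i : EuclideanSpace ℝ (Fin d)) (φ j) ∈ distanceSet S :=
      ⟨_, (φ i).2, _, (φ j).2, fun h => hne (Subtype.ext h), rfl⟩
    rw [hyd]
    split_ifs with hadj
    · exact (φ.map_adj_iff.mpr hadj).2.unique hgr
    · rw [hD] at hmem
      refine hmem.resolve_right fun hb => hadj (φ.map_adj_iff.mp ⟨hne, ?_⟩)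
      rw [Set.mem_singleton_iff] at hb
      rwa [hb]
  have hκ : 0 < b ^ 2 - a ^ 2 := by nlinarith
  have hinner : ∀ i j, inner ℝ (y i) (y j) = (2 * r ^ 2 - ‖y i - y j‖ ^ 2) / 2 := by
    intro i j
    rw [norm_sub_sq_real, hnorm, hnorm]
    ring
  have hgram : shiftedMatrix (G.adjMatrix ℝ) (a ^ 2 / (b ^ 2 - a ^ 2))
      ((2 * r ^ 2 - a ^ 2) / (b ^ 2 - a ^ 2)) = (2 / (b ^ 2 - a ^ 2)) • gram ℝ y := by
    ext i j
    rw [Matrix.smul_apply, gram_apply, hinner]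
    by_cases hij : i = j
    · subst hij
      simp [shiftedMatrix]
      field_simp
      ring
    · rw [hdist i j hij]
      by_cases hadj : G.Adj i j
      · simp [shiftedMatrix, one_apply, hij, hadj]
        field_simp
        ring
      · simp [shiftedMatrix, one_apply, hij, hadj]
  refine ⟨a ^ 2 / (b ^ 2 - a ^ 2), (2 * r ^ 2 - a ^ 2) / (b ^ 2 - a ^ 2), by positivity,
    by rw [hgram]; exact (posSemidef_gram ℝ y).smul (by positivity), ?_⟩
  rw [hgram]
  let L := Fintype.linearCombination ℝ y
  have hL := L.finrank_range_add_finrank_ker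
  have hrange : Module.finrank ℝ (LinearMap.range L) ≤ d :=
    (Submodule.finrank_le _).trans (by simp)
  have hle : LinearMap.ker L ≤
      LinearMap.ker (Matrix.toLin' ((2 / (b ^ 2 - a ^ 2)) • gram ℝ y)) := by
    intro x hx
    rw [LinearMap.mem_ker, Fintype.linearCombination_apply] at hx
    rw [LinearMap.mem_ker, toLin'_apply, smul_mulVec]
    have : gram ℝ y *ᵥ x = 0 := by
      ext i
      have h0 : inner ℝ (y i) (∑ j, x j • y j) = 0 := by rw [hx, inner_zero_right]
      rw [inner_sum] at h0
      simpa [mulVec, dotProduct, inner_smul_right, mul_comm] using h0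
    rw [this, smul_zero]
  have := Submodule.finrank_mono hle
  rw [Module.finrank_fintype_fun_eq_card] at hL
  omega

/-- If `θ I - A + s J` has a kernel of dimension at least two for some `θ > 0`, the graph
has an edge and a pair of distinct nonadjacent vertices. -/
theorem exists_adj_and_exists_not_adj {θ s : ℝ} (hθ : 0 < θ)
    (hker : 2 ≤ Module.finrank ℝ
      (LinearMap.ker (Matrix.toLin' (shiftedMatrix (G.adjMatrix ℝ) θ s)))) :
    (∃ i j, G.Adj i j) ∧ ∃ i j, i ≠ j ∧ ¬ G.Adj i j := by
  obtain ⟨v, hvN, hv0, hv1⟩ :=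
    Submodule.exists_ne_zero_mem_ker hker (dotProductBilin ℝ ℝ (1 : V → ℝ))
  rw [dotProductBilin_apply_apply] at hv1
  rw [LinearMap.mem_ker, toLin'_apply] at hvN
  have hAv := adjMatrix_mulVec_of_mem_ker G hvN hv1
  obtain ⟨i, hi⟩ := Function.ne_iff.mp hv0
  have hAvi := congrFun hAv i
  rw [Pi.smul_apply, smul_eq_mul] at hAvi
  constructor
  · by_contra! hno
    have : (G.adjMatrix ℝ *ᵥ v) i = 0 := by simp [mulVec, dotProduct, hno]
    rw [this] at hAvi
    exact mul_ne_zero hθ.ne' hi hAvi.symm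
  · by_contra! hall
    have : (G.adjMatrix ℝ *ᵥ v) i = 1 ⬝ᵥ v - v i := by
      rw [eq_sub_iff_add_eq]
      simp only [mulVec, dotProduct, Pi.one_apply, one_mul]
      rw [← Finset.add_sum_erase _ _ (Finset.mem_univ i),
        ← Finset.add_sum_erase _ v (Finset.mem_univ i)]
      simp only [SimpleGraph.adjMatrix_apply, SimpleGraph.irrefl, if_false, zero_mul, zero_add]
      rw [add_comm]
      congr 1
      refine Finset.sum_congr rfl fun j hj => ?_
      rw [if_pos (hall i j (Finset.ne_of_mem_erase hj).symm), one_mul]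
    rw [this, hv1] at hAvi
    have h0 : (θ + 1) * v i = 0 := by linarith
    exact mul_ne_zero (by linarith) hi h0

/-- Conversely, vectors in `ℝ^d` with Gram matrix `θ I - A + s J` lie on a sphere about the origin
and have squared distances `2θ + 2` and `2θ` along edges and non-edges. -/
theorem hasSphericalRepresentation_of_posSemidef {d : ℕ} {θ s : ℝ} (hθ : 0 < θ)
    (hN : (shiftedMatrix (G.adjMatrix ℝ) θ s).PosSemidef)
    (hker : 2 ≤ Module.finrank ℝ
      (LinearMap.ker (Matrix.toLin' (shiftedMatrix (G.adjMatrix ℝ) θ s))))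
    (hd : Fintype.card V ≤ d + Module.finrank ℝ
      (LinearMap.ker (Matrix.toLin' (shiftedMatrix (G.adjMatrix ℝ) θ s)))) :
    HasSphericalRepresentation G d := by
  obtain ⟨y, hy⟩ := exists_gram_eq_of_posSemidef hN hd
  obtain ⟨⟨i₁, j₁, h₁⟩, ⟨i₀, j₀, hne₀, h₀⟩⟩ := exists_adj_and_exists_not_adj G hθ hker
  have hinner : ∀ i j, inner ℝ (y i) (y j) = shiftedMatrix (G.adjMatrix ℝ) θ s i j := fun i j => by
    rw [← hy, gram_apply]
  have hnorm : ∀ i, ‖y i‖ ^ 2 = θ + s := fun i => by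
    rw [← real_inner_self_eq_norm_sq, hinner]
    simp [shiftedMatrix]
  have hdist : ∀ i j, i ≠ j →
      dist (y i) (y j) = if G.Adj i j then √(2 * θ + 2) else √(2 * θ) := by
    intro i j hij
    have hsq : dist (y i) (y j) ^ 2 = if G.Adj i j then 2 * θ + 2 else 2 * θ := by
      rw [dist_eq_norm, norm_sub_sq_real, hnorm, hnorm, hinner]
      by_cases hadj : G.Adj i j
      · simp [shiftedMatrix, one_apply, hij, hadj]
        ring
      · simp [shiftedMatrix, one_apply, hij, hadj]
        ring
    rw [← Real.sqrt_sq dist_nonneg, hsq]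
    split_ifs <;> rfl
  have hlt : √(2 * θ) < √(2 * θ + 2) := Real.sqrt_lt_sqrt (by positivity) (by linarith)
  have hpos : 0 < √(2 * θ) := Real.sqrt_pos.mpr (by positivity)
  have hinj : Function.Injective y := by
    intro i j hij
    by_contra hne
    have h := hdist i j hne
    rw [hij, dist_self] at h
    split_ifs at h <;> linarith
  have hD : distanceSet (Set.range y) = {√(2 * θ), √(2 * θ + 2)} := by
    ext t
    constructor
    · rintro ⟨_, ⟨i, rfl⟩, _, ⟨j, rfl⟩, hij, rfl⟩
      rw [hdist i j (fun h => hij (congrArg y h))]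
      split_ifs <;> simp
    · rintro (rfl | rfl)
      · exact ⟨_, ⟨i₀, rfl⟩, _, ⟨j₀, rfl⟩, hinj.ne hne₀, by rw [hdist _ _ hne₀, if_neg h₀]⟩
      · exact ⟨_, ⟨i₁, rfl⟩, _, ⟨j₁, rfl⟩, hinj.ne h₁.ne, by rw [hdist _ _ h₁.ne, if_pos h₁]⟩
  have hgr : IsGreatest (distanceSet (Set.range y)) √(2 * θ + 2) := by
    rw [hD]
    exact ⟨by simp, by rintro x (rfl | rfl); exacts [hlt.le, le_rfl]⟩
  have hr : 0 < θ + s := by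
    rw [← hnorm i₁]
    -- Two distinct points cannot both be the origin, so the common radius is positive.
    refine lt_of_le_of_ne (sq_nonneg _) fun h => h₁.ne (hinj ?_)
    have hz : ∀ i, y i = 0 := fun i => by
      have : ‖y i‖ ^ 2 = 0 := by rw [hnorm, ← hnorm i₁, ← h]
      simpa using this
    rw [hz, hz]
  refine ⟨Set.range y, ?_, ⟨0, √(θ + s), Real.sqrt_pos.mpr hr, ?_⟩, ⟨Equiv.ofInjective y hinj, ?_⟩⟩
  · rw [IsTwoDistanceSet, hD, Set.ncard_pair hlt.ne]
  · rintro _ ⟨i, rfl⟩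
    rw [mem_sphere_zero_iff_norm, ← hnorm i, Real.sqrt_sq (norm_nonneg _)]
  · intro i j
    change (_ ≠ _ ∧ IsGreatest _ (dist (y i) (y j))) ↔ _
    constructor
    · rintro ⟨hne, hg⟩
      have hij : i ≠ j := fun h => hne (by rw [h])
      have h := hg.unique hgr
      rw [hdist i j hij] at h
      by_contra hadj
      rw [if_neg hadj] at h
      exact hlt.ne h
    · intro hadj
      refine ⟨(Equiv.ofInjective y hinj).injective.ne hadj.ne, ?_⟩
      rwa [hdist i j hadj.ne, if_pos hadj]

end Realization

theorem theorem1p1 {V : Type*} [Fintype V] [DecidableEq V] (d : ℕ) (hd : 0 < d)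
    (hV : Fintype.card V = d + 2) (G : SimpleGraph V) [DecidableRel G.Adj]
    (lam1 lam2 : ℝ)
    (hlam1 : lam1 = adjEigenvalues G ⟨0, by omega⟩)
    (hlam2 : lam2 = adjEigenvalues G ⟨1, by omega⟩) :
    HasSphericalRepresentation G d ↔
      IsGreatest {μ : ℝ | Module.End.HasEigenvalue
          (Matrix.toLin' (projectedAdjMatrix G)) μ} lam2 ∧
        eigenMultiplicity (G.adjMatrix ℝ) lam2 =
          eigenMultiplicity (projectedAdjMatrix G) lam2 + (if lam1 = lam2 then 1 else 0) := by
  have : Nonempty V := Fintype.card_pos_iff.mp (by omega)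
  obtain ⟨e, f, hee, hff, hef, hAe, hAf, hle, hmax⟩ :=
    exists_top_two_eigenvectors (isHermitian_adjMatrix G) (by omega) (by omega)
  change lam1 = (isHermitian_adjMatrix G).eigenvalues₀ _ at hlam1
  change lam2 = (isHermitian_adjMatrix G).eigenvalues₀ _ at hlam2
  rw [← hlam1] at hAe hle
  rw [← hlam2] at hAf hle
  rw [← hlam2] at hmax
  constructor
  · intro h
    obtain ⟨θ, s, hθ, hN, hker⟩ := exists_posSemidef_of_hasSphericalRepresentation G h
    exact spectral_conditions_of_posSemidef G hee hff hef hAe hAf hle hmax hθ hN (by omega)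
  · rintro ⟨hgreatest, hmult⟩
    obtain ⟨hpos, s, hN, hker⟩ := exists_posSemidef_of_spectral_conditions G hee hff hef hAe hAf
      hle hmax hgreatest hmult
    exact hasSphericalRepresentation_of_posSemidef G hpos hN hker (by omega)
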